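/- Let $R$ be an associative ring with identity; modules are left $R$-modules unless said otherwise, and $X^{+}=\mathrm{Hom}_{\mathbb Z}(X,\mathbb Q/\mathbb Z)$ is the character module, which is a right module for a left module $X$ and a left module for a right module $X$. Let $\mathcal L$ be a class of left $R$-modules and $\mathcal A$ a class of right $R$-modules such that $(\mathcal L,\mathcal A)$ is a complete duality pair, that is: for every left module $L$, $L\in\mathcal L$ if and only if $L^{+}\in\mathcal A$; for every right module $A$, $A\in\mathcal A$ if and only if $A^{+}\in\mathcal L$; $\mathcal L$ and $\mathcal A$ are closed under direct summands and finite direct sums; and $\mathcal L$ contains ${}_RR$ and is closed under coproducts and extensions. An exact sequence of modules is called $\mathrm{Hom}_R(-,\mathcal L)$-exact if it stays exact after applying $\mathrm{Hom}_R(-,L)$ for every $L\in\mathcal L$. A module $M$ is called Gorenstein $(\mathcal L,\mathcal A)$-projective if there is a $\mathrm{Hom}_R(-,\mathcal L)$-exact exact sequence $\cdots\to P_1\to P_0\to P_{-1}\to P_{-2}\to\cdots$ of projective modules with $M\cong\ker(P_{-1}\to P_{-2})$. It is called strongly Gorenstein $(\mathcal L,\mathcal A)$-projective if there is a $\mathrm{Hom}_R(-,\mathcal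 L)$-exact exact sequence $\cdots\to P\xrightarrow{f}P\xrightarrow{f}P\xrightarrow{f}\cdots$ with $P$ projective and $M\cong\ker f$. For a module $G$ put $G^{\perp}=\{Y\mid \mathrm{Ext}^1_R(G,Y)=0\}$, and for a class $\mathcal Y$ of modules put ${}^{\perp}\mathcal Y=\{X\mid \mathrm{Ext}^1_R(X,Y)=0 \text{ for all } Y\in\mathcal Y\}$. Then for every left $R$-module $M$ the following are equivalent: (1) $M$ is Gorenstein $(\mathcal L,\mathcal A)$-projective. (2) $M$ is a direct summand of some strongly Gorenstein $(\mathcal L,\mathcal A)$-projective module. (3) There exists a strongly Gorenstein $(\mathcal L,\mathcal A)$-projective module $G$ such that $M\in{}^{\perp}(G^{\perp})$. -/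

import Mathlib

open CategoryTheory CategoryTheory.Limits

universe u

namespace GorensteinLA

/-- `X` is a direct summand of `Y`, up to isomorphism. -/
def IsDirectSummand {R : Type u} [Ring R] (X Y : ModuleCat.{u} R) : Prop :=
  ∃ Z : ModuleCat.{u} R, Nonempty (Y ≅ X ⊞ Z)

/-- The right `R`-action on `M⁺ = Hom_ℤ(M, ℚ/ℤ)` for a left `R`-module `M`,
`(φ · r)(x) = φ (r x)`.  Right `R`-modules are modules over `Rᵐᵒᵖ`. -/
@[reducible] def charModuleStructure (R : Type u) [Ring R]
    (M : Type u) [AddCommGroup M] [Module R M] :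
    Module Rᵐᵒᵖ (CharacterModule M) where
  smul r φ := AddMonoidHom.comp φ (DistribSMul.toAddMonoidHom M r.unop)
  one_smul φ := by ext x; exact congrArg φ (one_smul R x)
  mul_smul r s φ := by ext x; exact congrArg φ (mul_smul s.unop r.unop x)
  smul_zero r := rfl
  smul_add r φ ψ := rfl
  add_smul r s φ := by
    ext x
    exact (congrArg φ (add_smul r.unop s.unop x)).trans (map_add φ _ _)
  zero_smul φ := by ext x; exact (congrArg φ (zero_smul R x)).trans (map_zero φ)

/-- The left `R`-action on `N⁺ = Hom_ℤ(N, ℚ/ℤ)` for a right `R`-module `N`,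
`(r φ)(x) = φ (x r)`. -/
@[reducible] def charModuleStructureOp (R : Type u) [Ring R]
    (N : Type u) [AddCommGroup N] [Module Rᵐᵒᵖ N] :
    Module R (CharacterModule N) where
  smul r φ := AddMonoidHom.comp φ (DistribSMul.toAddMonoidHom N (MulOpposite.op r))
  one_smul φ := by ext x; exact congrArg φ (one_smul Rᵐᵒᵖ x)
  mul_smul r s φ := by
    ext x; exact congrArg φ (mul_smul (MulOpposite.op s) (MulOpposite.op r) x)
  smul_zero r := rfl
  smul_add r φ ψ := rfl
  add_smul r s φ := by
    ext x
    exact (congrArg φ (add_smul (MulOpposite.op r) (MulOpposite.op s) x)).trans (map_add φ _ _)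
  zero_smul φ := by ext x; exact (congrArg φ (zero_smul Rᵐᵒᵖ x)).trans (map_zero φ)

/-- The character module `M⁺` of a left `R`-module, as a right `R`-module. -/
def charModule {R : Type u} [Ring R] (M : ModuleCat.{u} R) : ModuleCat.{u} Rᵐᵒᵖ :=
  letI := charModuleStructure R M
  ModuleCat.of Rᵐᵒᵖ (CharacterModule M)

/-- The character module `N⁺` of a right `R`-module, as a left `R`-module. -/
def charModuleOp {R : Type u} [Ring R] (N : ModuleCat.{u} Rᵐᵒᵖ) : ModuleCat.{u} R :=
  letI := charModuleStructureOp R N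
  ModuleCat.of R (CharacterModule N)

/-- A class of modules is closed under direct summands (in particular under isomorphisms) and
finite direct sums. -/
structure IsSummandSumClosed {R : Type u} [Ring R] (𝒜 : ObjectProperty (ModuleCat.{u} R)) :
    Prop where
  summand : ∀ X Y : ModuleCat.{u} R, IsDirectSummand X Y → 𝒜 Y → 𝒜 X
  sum : ∀ X Y : ModuleCat.{u} R, 𝒜 X → 𝒜 Y → 𝒜 (X ⊞ Y)

/-- `(ℒ, 𝒜)` is a duality pair over `R`: `ℒ` a class of left and `𝒜` a class of right modules. -/
structure IsDualityPair {R : Type u} [Ring R] (ℒ : ObjectProperty (ModuleCat.{u} R))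
    (𝒜 : ObjectProperty (ModuleCat.{u} Rᵐᵒᵖ)) : Prop where
  mem_iff : ∀ M : ModuleCat.{u} R, ℒ M ↔ 𝒜 (charModule M)
  closed : IsSummandSumClosed 𝒜

/-- `(𝒜, ℒ)` is a duality pair, with `𝒜` a class of right and `ℒ` a class of left modules. -/
structure IsDualityPairOp {R : Type u} [Ring R] (𝒜 : ObjectProperty (ModuleCat.{u} Rᵐᵒᵖ))
    (ℒ : ObjectProperty (ModuleCat.{u} R)) : Prop where
  mem_iff : ∀ N : ModuleCat.{u} Rᵐᵒᵖ, 𝒜 N ↔ ℒ (charModuleOp N)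
  closed : IsSummandSumClosed ℒ

/-- A perfect duality pair: `ℒ` contains `R` and is closed under coproducts and extensions. -/
structure IsPerfectDualityPair {R : Type u} [Ring R] (ℒ : ObjectProperty (ModuleCat.{u} R))
    (𝒜 : ObjectProperty (ModuleCat.{u} Rᵐᵒᵖ)) : Prop extends IsDualityPair ℒ 𝒜 where
  ring_mem : ℒ (ModuleCat.of R R)
  coproduct : ∀ (ι : Type u) (X : ι → ModuleCat.{u} R), (∀ i, ℒ (X i)) → ℒ (∐ X)
  extension : ∀ S : ShortComplex (ModuleCat.{u} R), S.ShortExact → ℒ S.X₁ → ℒ S.X₃ → ℒ S.X₂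

/-- A complete duality pair: perfect, and `{ℒ, 𝒜}` is symmetric. -/
structure IsCompleteDualityPair {R : Type u} [Ring R] (ℒ : ObjectProperty (ModuleCat.{u} R))
    (𝒜 : ObjectProperty (ModuleCat.{u} Rᵐᵒᵖ)) : Prop extends IsPerfectDualityPair ℒ 𝒜 where
  symm : IsDualityPairOp 𝒜 ℒ

/-- `Hom_R(P, L)` is exact (at every degree) for every `L` in `ℒ`. -/
def IsHomExact {R : Type u} [Ring R] (ℒ : ObjectProperty (ModuleCat.{u} R))
    (P : ChainComplex (ModuleCat.{u} R) ℤ) : Prop :=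
  ∀ L : ModuleCat.{u} R, ℒ L → ∀ n : ℤ,
    Function.Exact (fun g : P.X (n - 1) ⟶ L => P.d n (n - 1) ≫ g)
      (fun g : P.X n ⟶ L => P.d (n + 1) n ≫ g)

/-- Gorenstein `(ℒ, 𝒜)`-projective modules; the definition involves only `ℒ`. -/
def IsGorensteinProjective {R : Type u} [Ring R] (ℒ : ObjectProperty (ModuleCat.{u} R))
    (M : ModuleCat.{u} R) : Prop :=
  ∃ P : ChainComplex (ModuleCat.{u} R) ℤ,
    (∀ n, Projective (P.X n)) ∧ P.Acyclic ∧ IsHomExact ℒ P ∧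
      Nonempty (M ≅ kernel (P.d (-1) (-2)))

/-- Strongly Gorenstein `(ℒ, 𝒜)`-projective modules: the complex is the periodic one
`⋯ → P → P → P → ⋯` with all differentials equal to `f`. -/
def IsStronglyGorensteinProjective {R : Type u} [Ring R]
    (ℒ : ObjectProperty (ModuleCat.{u} R)) (M : ModuleCat.{u} R) : Prop :=
  ∃ (P : ModuleCat.{u} R) (f : P ⟶ P), Projective P ∧
    Function.Exact f f ∧
    (∀ L : ModuleCat.{u} R, ℒ L →
      Function.Exact (fun g : P ⟶ L => f ≫ g) (fun g : P ⟶ L => f ≫ g)) ∧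
    Nonempty (M ≅ kernel f)

/-- `𝒳^⊥`, the modules `Y` with `Ext¹(X, Y) = 0` for all `X` in `𝒳`. -/
def rightPerp {R : Type u} [Ring R] (𝒳 : ObjectProperty (ModuleCat.{u} R)) :
    ObjectProperty (ModuleCat.{u} R) :=
  fun Y => ∀ X : ModuleCat.{u} R, 𝒳 X → Subsingleton (Abelian.Ext X Y 1)

/-- `^⊥𝒴`, the modules `X` with `Ext¹(X, Y) = 0` for all `Y` in `𝒴`. -/
def leftPerp {R : Type u} [Ring R] (𝒴 : ObjectProperty (ModuleCat.{u} R)) :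
    ObjectProperty (ModuleCat.{u} R) :=
  fun X => ∀ Y : ModuleCat.{u} R, 𝒴 Y → Subsingleton (Abelian.Ext X Y 1)

end GorensteinLA

/-!
The two easy implications are (1) → (2) → (3). If `M` is a cycle module of a totally acyclic
complex `P`, the differentials of `P` assemble to an endomorphism `sumD P` of the direct sum of all
`P.X n`; its kernel is strongly Gorenstein projective and has every cycle module of `P` as a retract
(`exists_isDirectSummand_of_isGorensteinProjective`). A retract of `G` has no `Ext¹` into any module
into which `G` has none (`mem_leftPerp_of_isDirectSummand`).

For (3) → (1), a strongly Gorenstein projective `G` sits in a short exact sequence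
`0 ⟶ G ⟶ P ⟶ G ⟶ 0`, with maps `i` and `p` and with `P` projective, so that `Y` lies in `G^⊥` if and
only if every map `G ⟶ Y` extends along `i` (`extendsAlong i`). Because `G` is its own syzygy, this
class is closed under kernels of epimorphisms and cokernels of monomorphisms (`extendsAlong_left`,
`extendsAlong_right`), and it contains `ℒ`, in particular free modules covering any given module.
Hence:

* the modules in both `^⊥(G^⊥)` and `G^⊥` are projective (`projective_of_mem_core`);
* `^⊥(G^⊥)` is closed under kernels of epimorphisms from projectives (`leftPerp_left`);
* the small object argument applied to the single map `i` embeds any `M` into some `W` in `G^⊥` with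
  cokernel in `^⊥(G^⊥)` (`exists_special_preenvelope`), and when `M` lies in `^⊥(G^⊥)`, so does `W`,
  which is then projective.

Therefore every `M` in `^⊥(G^⊥)` is both the left and the right end of a short exact sequence with
projective middle term and third term in `^⊥(G^⊥)`. Splicing such sequences in both directions
(`splice`) gives an acyclic complex of projectives, and it stays exact under `Hom(-, L)` for `L` in
`ℒ` because `ℒ` is contained in `G^⊥`.
-/

namespace GorensteinLA

section Abelian

variable {C : Type*} [Category* C] [Abelian C]

/-! ### Vanishing of `Ext¹` through extensions and lifts of morphisms -/

section ExtOne

variable [HasExt C]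

lemma exists_extension_of_subsingleton_ext {S : ShortComplex C} (hS : S.ShortExact) {Y : C}
    (h : Subsingleton (Abelian.Ext S.X₃ Y 1)) (g : S.X₁ ⟶ Y) : ∃ k : S.X₂ ⟶ Y, S.f ≫ k = g := by
  obtain ⟨x, hx⟩ := Abelian.Ext.contravariant_sequence_exact₁ hS Y (Abelian.Ext.mk₀ g)
    (add_zero 1) (Subsingleton.elim _ _)
  obtain ⟨k, rfl⟩ := Abelian.Ext.homEquiv₀.symm.surjective x
  refine ⟨k, Abelian.Ext.homEquiv₀.symm.injective ?_⟩
  simpa using hx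

lemma exists_lift_of_subsingleton_ext {S : ShortComplex C} (hS : S.ShortExact) {X : C}
    (h : Subsingleton (Abelian.Ext X S.X₁ 1)) (g : X ⟶ S.X₃) : ∃ k : X ⟶ S.X₂, k ≫ S.g = g := by
  obtain ⟨x, hx⟩ := Abelian.Ext.covariant_sequence_exact₃ X hS (Abelian.Ext.mk₀ g)
    (zero_add 1) (Subsingleton.elim _ _)
  obtain ⟨k, rfl⟩ := Abelian.Ext.homEquiv₀.symm.surjective x
  refine ⟨k, Abelian.Ext.homEquiv₀.symm.injective ?_⟩
  simpa using hx

lemma subsingleton_ext_of_extension {S : ShortComplex C} (hS : S.ShortExact) {Y : C}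
    [Subsingleton (Abelian.Ext S.X₂ Y 1)] (h : ∀ g : S.X₁ ⟶ Y, ∃ k : S.X₂ ⟶ Y, S.f ≫ k = g) :
    Subsingleton (Abelian.Ext S.X₃ Y 1) := by
  refine subsingleton_of_forall_eq 0 fun e ↦ ?_
  obtain ⟨x, rfl⟩ := Abelian.Ext.contravariant_sequence_exact₃ hS Y e
    (Subsingleton.elim _ _) (add_zero 1)
  obtain ⟨g, rfl⟩ := Abelian.Ext.homEquiv₀.symm.surjective x
  obtain ⟨k, rfl⟩ := h g
  simp [← Abelian.Ext.mk₀_comp_mk₀]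

lemma subsingleton_ext_of_lift {S : ShortComplex C} (hS : S.ShortExact) {X : C}
    [Subsingleton (Abelian.Ext X S.X₂ 1)] (h : ∀ g : X ⟶ S.X₃, ∃ k : X ⟶ S.X₂, k ≫ S.g = g) :
    Subsingleton (Abelian.Ext X S.X₁ 1) := by
  refine subsingleton_of_forall_eq 0 fun e ↦ ?_
  obtain ⟨x, rfl⟩ := Abelian.Ext.covariant_sequence_exact₁ X hS e
    (Subsingleton.elim _ _) (zero_add 1)
  obtain ⟨g, rfl⟩ := Abelian.Ext.homEquiv₀.symm.surjective x
  obtain ⟨k, rfl⟩ := h g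
  simp [← Abelian.Ext.mk₀_comp_mk₀]

lemma subsingleton_ext_middle {S : ShortComplex C} (hS : S.ShortExact) {Y : C}
    [Subsingleton (Abelian.Ext S.X₁ Y 1)] [Subsingleton (Abelian.Ext S.X₃ Y 1)] :
    Subsingleton (Abelian.Ext S.X₂ Y 1) := by
  refine subsingleton_of_forall_eq 0 fun e ↦ ?_
  obtain ⟨x, rfl⟩ := Abelian.Ext.contravariant_sequence_exact₂ hS Y e (Subsingleton.elim _ _)
  simp [Subsingleton.elim x 0]

lemma subsingleton_ext_of_retract {X X' Y : C} (r : Retract X X')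
    [Subsingleton (Abelian.Ext X' Y 1)] : Subsingleton (Abelian.Ext X Y 1) := by
  refine subsingleton_of_forall_eq 0 fun e ↦ ?_
  have h := Abelian.Ext.mk₀_comp_mk₀_assoc r.i r.r e
  rw [Subsingleton.elim ((Abelian.Ext.mk₀ r.r).comp e (zero_add 1)) 0] at h
  simpa using h.symm

end ExtOne

/-! ### The right orthogonal of an object that is its own syzygy -/

/-- The objects `Y` such that every morphism to `Y` from the source of `i` extends along `i`. -/
def extendsAlong {G P : C} (i : G ⟶ P) : ObjectProperty C :=
  fun Y ↦ ∀ g : G ⟶ Y, ∃ k : P ⟶ Y, i ≫ k = g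

section Periodic

variable {G P : C} {i : G ⟶ P} {p : P ⟶ G} {w : i ≫ p = 0}

lemma subsingleton_ext_iff_extendsAlong [HasExt C] (hS : (ShortComplex.mk i p w).ShortExact)
    [Projective P] (Y : C) : Subsingleton (Abelian.Ext G Y 1) ↔ extendsAlong i Y :=
  ⟨fun h ↦ exists_extension_of_subsingleton_ext hS h, fun h ↦
    have : Subsingleton (Abelian.Ext (ShortComplex.mk i p w).X₂ Y 1) :=
      Abelian.Ext.subsingleton_of_projective P Y 0
    subsingleton_ext_of_extension hS h⟩

/-- Extend `G ⟶ X₁ ⟶ X₂` to `a : P ⟶ X₂`. Composed with `X₂ ⟶ X₃` it factors through `p`; the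
resulting map `G ⟶ X₃` extends to `P`, lifts to `d : P ⟶ X₂`, and `a - p ≫ i ≫ d` lands in `X₁`. -/
lemma extendsAlong_left (hS : (ShortComplex.mk i p w).ShortExact) [Projective P]
    {S : ShortComplex C} (h : S.ShortExact) (h₂ : extendsAlong i S.X₂)
    (h₃ : extendsAlong i S.X₃) : extendsAlong i S.X₁ := by
  intro g
  have := h.mono_f
  have := h.epi_g
  have : Epi p := hS.epi_g
  obtain ⟨a, ha⟩ := h₂ (g ≫ S.f)
  let b : G ⟶ S.X₃ := hS.exact.desc (a ≫ S.g) (by simp [reassoc_of% ha])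
  have hb : p ≫ b = a ≫ S.g := hS.exact.g_desc _ _
  obtain ⟨c, hc⟩ := h₃ b
  let d := Projective.factorThru c S.g
  have hd : d ≫ S.g = c := Projective.factorThru_comp c S.g
  have hi : (a - p ≫ i ≫ d) ≫ S.g = 0 := by simp [hd, hc, hb]
  refine ⟨h.exact.lift _ hi, ?_⟩
  rw [← cancel_mono S.f, Category.assoc, h.exact.lift_f]
  simp [ha, reassoc_of% w]

/-- Every map `g : G ⟶ X₃` lifts to a map `d : G ⟶ X₂`, as `Ext¹(G, X₁)` vanishes: lift `p ≫ g` to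
`a : P ⟶ X₂` and correct `a` by a map `P ⟶ X₁` so that it kills `i`. Then extend `d` along `i`. -/
lemma extendsAlong_right (hS : (ShortComplex.mk i p w).ShortExact) [Projective P]
    {S : ShortComplex C} (h : S.ShortExact) (h₁ : extendsAlong i S.X₁)
    (h₂ : extendsAlong i S.X₂) : extendsAlong i S.X₃ := by
  intro g
  have := h.mono_f
  have := h.epi_g
  have : Epi p := hS.epi_g
  let a := Projective.factorThru (p ≫ g) S.g
  have ha : a ≫ S.g = p ≫ g := Projective.factorThru_comp _ S.g
  let c : G ⟶ S.X₁ := h.exact.lift (i ≫ a) (by simp [ha, reassoc_of% w])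
  have hc : c ≫ S.f = i ≫ a := h.exact.lift_f _ _
  obtain ⟨b, hb⟩ := h₁ c
  let d : G ⟶ S.X₂ := hS.exact.desc (a - b ≫ S.f) (by simp [reassoc_of% hb, hc])
  have hd : p ≫ d = a - b ≫ S.f := hS.exact.g_desc _ _
  have hdg : d ≫ S.g = g := by
    rw [← cancel_epi p, reassoc_of% hd]
    simp [ha]
  obtain ⟨e, he⟩ := h₂ d
  exact ⟨e ≫ S.g, by rw [reassoc_of% he, hdg]⟩

/-- An epimorphism whose kernel extends morphisms along `i` has the right lifting property against
`i`, because the target of `i` is projective. -/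
lemma rlp_of_extendsAlong [Projective P] {S : ShortComplex C} (h : S.ShortExact)
    (h₁ : extendsAlong i S.X₁) :
    (MorphismProperty.ofHoms fun _ : PUnit.{u + 1} ↦ i).rlp S.g := by
  rintro _ _ _ ⟨⟩
  refine ⟨fun {a b} sq ↦ ?_⟩
  have := h.mono_f
  have := h.epi_g
  let c := Projective.factorThru b S.g
  have hc : c ≫ S.g = b := Projective.factorThru_comp b S.g
  let d : G ⟶ S.X₁ := h.exact.lift (a - i ≫ c) (by simp [hc, sq.w])
  have hd : d ≫ S.f = a - i ≫ c := h.exact.lift_f _ _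
  obtain ⟨e, he⟩ := h₁ d
  exact ⟨⟨⟨c + e ≫ S.f, by simp [reassoc_of% he, hd], by simp [hc]⟩⟩⟩

end Periodic

/-! ### Special preenvelopes by the small object argument -/

section SmallObject

variable [IsGrothendieckAbelian.{u} C] {G P : C} (i : G ⟶ P) [Mono i]

/-- A monomorphism of a Grothendieck abelian category permits the small object argument: relative
cell complexes are transfinite compositions of monomorphisms, and mapping out of `G` commutes with
`κ`-filtered colimits of monomorphisms for a regular `κ` above the number of subobjects of `G`. -/
lemma hasSmallObjectArgument_ofHoms_mono :
    MorphismProperty.HasSmallObjectArgument.{u}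
      (MorphismProperty.ofHoms fun _ : PUnit.{u + 1} ↦ i) := by
  obtain ⟨κ, hκ', hκ⟩ := HasCardinalLT.exists_regular_cardinal.{u} (Subobject G)
  have : Fact κ.IsRegular := ⟨hκ'⟩
  have : Nonempty κ.ord.ToType := by simpa using hκ'.ne_zero
  have := WellFoundedLT.toOrderBot κ.ord.ToType
  exact ⟨κ, inferInstance, inferInstance,
    { preservesColimit {A B X Y} j hj f hf := by
        let hf' : (MorphismProperty.monomorphisms C).TransfiniteCompositionOfShape
            κ.ord.ToType f :=
          { toTransfiniteCompositionOfShape := hf.toTransfiniteCompositionOfShape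
            map_mem k hk := by
              have := (hf.attachCells k hk).pushouts_coproducts
              simp only [MorphismProperty.ofHoms_homFamily] at this
              refine (?_ : _ ≤ MorphismProperty.monomorphisms C) _ this
              simp only [MorphismProperty.pushouts_le_iff, MorphismProperty.coproducts_le_iff]
              rintro _ _ _ ⟨⟩
              exact inferInstanceAs (Mono i) }
        have (k k' : κ.ord.ToType) (φ : k ⟶ k') : Mono (hf'.F.map φ) := hf'.mem_map φ
        obtain ⟨⟩ := hj
        exact IsGrothendieckAbelian.preservesColimit_coyoneda_obj_of_mono (Y := hf'.F) (κ := κ)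
          hκ }⟩

variable [HasExt C]

open ZeroObject in
/-- The factorization `M ⟶ W ⟶ 0` of the small object argument for `i`. As `W ⟶ 0` has the right
lifting property against `i`, the object `W` extends morphisms along `i`. The map `j : M ⟶ W` lifts
against every map having that property: lifting against `E ⟶ 0` for an injective `E` containing `M`
shows that `j` is a monomorphism, and lifting against `E ⟶ E / Y` for an injective `E` containing `Y`
shows that `Ext¹(cokernel j, Y)` vanishes. -/
lemma exists_special_preenvelope [Projective P] (M : C) :
    ∃ (W : C) (j : M ⟶ W), Mono j ∧ extendsAlong i W ∧
      ∀ Y, extendsAlong i Y → Subsingleton (Abelian.Ext (cokernel j) Y 1) := by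
  let I : MorphismProperty C := .ofHoms fun _ : PUnit.{u + 1} ↦ i
  have : I.HasSmallObjectArgument := hasSmallObjectArgument_ofHoms_mono i
  let fac := MorphismProperty.factorizationData I.rlp.llp I.rlp (0 : M ⟶ 0)
  let E (Y : C) : ShortComplex C := .mk (Injective.ι Y) (cokernel.π (Injective.ι Y)) (by simp)
  have hE (Y : C) : (E Y).ShortExact :=
    { exact := ShortComplex.exact_cokernel _
      mono_f := inferInstanceAs (Mono (Injective.ι Y))
      epi_g := inferInstanceAs (Epi (cokernel.π _)) }
  have lift {X Y : C} (q : X ⟶ Y) (hq : I.rlp q) (a : M ⟶ X) (b : fac.Z ⟶ Y)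
      (sq : a ≫ q = fac.i ≫ b) : ∃ l : fac.Z ⟶ X, fac.i ≫ l = a ∧ l ≫ q = b := by
    have := fac.hi q hq
    have sq' : CommSq a fac.i q b := ⟨sq⟩
    exact ⟨sq'.lift, sq'.fac_left, sq'.fac_right⟩
  have hmono : Mono fac.i := by
    obtain ⟨l, hl, -⟩ := lift (0 : Injective.under M ⟶ 0) (by
      rintro _ _ _ ⟨⟩
      exact ⟨fun {a b} sq ↦ ⟨⟨⟨Injective.factorThru a i, by simp,
        (isZero_zero C).eq_of_tgt _ _⟩⟩⟩⟩) (Injective.ι M) 0 (by simp)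
    exact mono_of_mono_fac hl
  refine ⟨fac.Z, fac.i, hmono, fun g ↦ ?_, fun Y hY ↦ ?_⟩
  · have := fac.hp i ⟨⟨⟩⟩
    have sq : CommSq g i fac.p 0 := ⟨(isZero_zero C).eq_of_tgt _ _⟩
    exact ⟨sq.lift, sq.fac_left⟩
  · have : Subsingleton (Abelian.Ext (cokernel fac.i) (E Y).X₂ 1) :=
      Abelian.Ext.subsingleton_of_injective _ (Injective.under Y) 0
    refine subsingleton_ext_of_lift (hE Y) fun g ↦ ?_
    obtain ⟨l, hl, hl'⟩ := lift (E Y).g (rlp_of_extendsAlong (hE Y) hY) 0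
      (cokernel.π fac.i ≫ g) (by simp)
    refine ⟨cokernel.desc fac.i l hl, ?_⟩
    rw [← cancel_epi (cokernel.π fac.i), cokernel.π_desc_assoc, hl']

end SmallObject

end Abelian

/-! ### Splicing short exact sequences -/

section Splice

/-- A relation that is serial in both directions admits a bi-infinite chain through any point. -/
lemma exists_int_sequence {α : Type*} (r : α → α → Prop) (hr : ∀ x, ∃ y, r x y)
    (hl : ∀ x, ∃ y, r y x) (a : α) : ∃ f : ℤ → α, f 0 = a ∧ ∀ n, r (f n) (f (n + 1)) := by
  choose s hs using hr
  choose t ht using hl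
  let f : ℤ → α
    | Int.ofNat n => s^[n] a
    | Int.negSucc n => t^[n + 1] a
  refine ⟨f, rfl, ?_⟩
  rintro (n | n)
  · change r (s^[n] a) (s^[n + 1] a)
    rw [Function.iterate_succ_apply']
    exact hs _
  · have h (k : ℕ) : r (t^[k + 1] a) (t^[k] a) := by
      rw [Function.iterate_succ_apply']
      exact ht _
    cases n with
    | zero => exact h 0
    | succ k => exact h (k + 1)

variable {C : Type*} [Category* C] [Abelian C] {Z X : ℤ → C} (ι : ∀ n, Z (n + 1) ⟶ X n)
  (π : ∀ n, X n ⟶ Z n) (w : ∀ n, ι n ≫ π n = 0)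

/-- The complex with differentials `X (n + 1) ⟶ Z (n + 1) ⟶ X n`, spliced from the short
complexes `Z (n + 1) ⟶ X n ⟶ Z n`. -/
noncomputable def splice : ChainComplex C ℤ :=
  ChainComplex.of X (fun n ↦ π (n + 1) ≫ ι n) fun n ↦ by simp [reassoc_of% w]

lemma splice_d (n : ℤ) : (splice ι π w).d (n + 1) n = π (n + 1) ≫ ι n :=
  ChainComplex.of_d X (fun n ↦ π (n + 1) ≫ ι n) n

variable {ι π w}

lemma splice_acyclic (hS : ∀ n, (ShortComplex.mk (ι n) (π n) (w n)).ShortExact) :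
    (splice ι π w).Acyclic := by
  intro n
  obtain ⟨m, rfl⟩ : ∃ m, n = m + 1 := ⟨n - 1, by simp⟩
  rw [HomologicalComplex.exactAt_iff' _ (m + 1 + 1) (m + 1) m (by simp) (by simp)]
  have : Epi (π (m + 1 + 1)) := (hS _).epi_g
  have : Mono (ι m) := (hS _).mono_f
  -- Precomposing with an epimorphism, and postcomposing with a monomorphism, preserves exactness.
  have h₁ : (ShortComplex.mk (π (m + 1 + 1) ≫ ι (m + 1)) (π (m + 1)) (by simp [w])).Exact := by
    let φ : ShortComplex.mk (π (m + 1 + 1) ≫ ι (m + 1)) (π (m + 1)) (by simp [w]) ⟶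
        ShortComplex.mk (ι (m + 1)) (π (m + 1)) (w _) :=
      { τ₁ := π (m + 1 + 1), τ₂ := 𝟙 _, τ₃ := 𝟙 _ }
    have : Epi φ.τ₁ := ‹_›
    have : IsIso φ.τ₂ := inferInstanceAs (IsIso (𝟙 _))
    have : Mono φ.τ₃ := inferInstanceAs (Mono (𝟙 _))
    exact (ShortComplex.exact_iff_of_epi_of_isIso_of_mono φ).2 (hS _).exact
  let ψ : ShortComplex.mk (π (m + 1 + 1) ≫ ι (m + 1)) (π (m + 1)) (by simp [w]) ⟶
      (splice ι π w).sc' (m + 1 + 1) (m + 1) m :=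
    { τ₁ := 𝟙 (X (m + 1 + 1)), τ₂ := 𝟙 (X (m + 1)), τ₃ := ι m
      comm₁₂ := (Category.id_comp _).trans ((splice_d ι π w _).trans (Category.comp_id _).symm)
      comm₂₃ := (Category.id_comp _).trans (splice_d ι π w _) }
  have : Epi ψ.τ₁ := inferInstanceAs (Epi (𝟙 _))
  have : IsIso ψ.τ₂ := inferInstanceAs (IsIso (𝟙 _))
  have : Mono ψ.τ₃ := ‹_›
  exact (ShortComplex.exact_iff_of_epi_of_isIso_of_mono ψ).1 h₁

lemma nonempty_iso_kernel_splice_d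
    (hS : ∀ n, (ShortComplex.mk (ι n) (π n) (w n)).ShortExact) {n m : ℤ} (h : m + 1 = n) :
    Nonempty (Z (n + 1) ≅ kernel ((splice ι π w).d n m)) := by
  subst h
  rw [splice_d]
  have : Mono (ι m) := (hS _).mono_f
  exact ⟨(hS (m + 1)).fIsKernel.conePointUniqueUpToIso (kernelIsKernel (π (m + 1))) ≪≫
    (kernelCompMono (π (m + 1)) (ι m)).symm⟩

lemma splice_hom_exact (hS : ∀ n, (ShortComplex.mk (ι n) (π n) (w n)).ShortExact) {L : C}
    (hL : ∀ n, extendsAlong (ι n) L) {a b c : ℤ} (hab : b + 1 = a) (hbc : c + 1 = b) :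
    Function.Exact (fun g : (splice ι π w).X c ⟶ L ↦ (splice ι π w).d b c ≫ g)
      (fun g : (splice ι π w).X b ⟶ L ↦ (splice ι π w).d a b ≫ g) := by
  subst hab hbc
  intro g
  constructor
  · intro hg
    have : Epi (π (c + 1 + 1)) := (hS _).epi_g
    have : Epi (ShortComplex.mk (ι (c + 1)) (π (c + 1)) (w _)).g := (hS _).epi_g
    change X (c + 1) ⟶ L at g
    have hg' : ι (c + 1) ≫ g = 0 := by
      rw [splice_d] at hg
      rw [← cancel_epi (π (c + 1 + 1)), comp_zero, ← Category.assoc]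
      exact hg
    obtain ⟨k, hk⟩ := hL c ((hS (c + 1)).exact.desc g hg')
    refine ⟨k, ?_⟩
    simp only [splice_d]
    exact (Category.assoc _ _ _).trans ((congrArg _ hk).trans ((hS (c + 1)).exact.g_desc g hg'))
  · rintro ⟨k, rfl⟩
    simp

end Splice

/-! ### Direct summands as retracts -/

section Retract

lemma isDirectSummand_of_retract {R : Type u} [Ring R] {X Y : ModuleCat.{u} R} (r : Retract X Y) :
    IsDirectSummand X Y := by
  let S : ShortComplex (ModuleCat.{u} R) := .mk r.i (cokernel.π r.i) (by simp)
  exact ⟨cokernel r.i, ⟨(ShortComplex.Splitting.ofExactOfRetraction S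
    (ShortComplex.exact_cokernel _) r.r r.retract
    (inferInstanceAs (Epi (cokernel.π _)))).isoBinaryBiproduct⟩⟩

lemma IsDirectSummand.retract {R : Type u} [Ring R] {X Y : ModuleCat.{u} R}
    (h : IsDirectSummand X Y) : Nonempty (Retract X Y) := by
  obtain ⟨Z, ⟨e⟩⟩ := h
  exact ⟨⟨biprod.inl ≫ e.inv, e.hom ≫ biprod.fst, by simp⟩⟩

end Retract

/-! ### The cotorsion pair generated by a strongly Gorenstein projective module -/

section Modules

variable {R : Type u} [Ring R] {ℒ : ObjectProperty (ModuleCat.{u} R)}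
  {G : ModuleCat.{u} R}

/-- A strongly Gorenstein projective module is its own syzygy; exactness of the periodic complex under
`Hom(-, L)` says that maps from `G` to `L` extend along `i`. -/
lemma IsStronglyGorensteinProjective.exists_shortExact
    (hG : IsStronglyGorensteinProjective ℒ G) :
    ∃ (P : ModuleCat.{u} R) (i : G ⟶ P) (p : P ⟶ G) (w : i ≫ p = 0), Projective P ∧
      (ShortComplex.mk i p w).ShortExact ∧ ∀ L, ℒ L → extendsAlong i L := by
  obtain ⟨P, f, hP, hf, hL, ⟨e⟩⟩ := hG
  have hff : f ≫ f = 0 := by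
    ext x
    exact hf.apply_apply_eq_zero x
  have hex : (ShortComplex.mk f f hff).Exact :=
    (ShortComplex.ShortExact.moduleCat_exact_iff_function_exact _).2 hf
  have hepi : Epi (kernel.lift f f hff) := hex.epi_kernelLift
  let i : G ⟶ P := e.hom ≫ kernel.ι f
  let p : P ⟶ G := kernel.lift f f hff ≫ e.inv
  have hpi : p ≫ i = f := by simp [p, i]
  have : Mono i := mono_comp _ _
  have : Epi p := epi_comp _ _
  have hif : i ≫ f = 0 := by simp [i]
  have w : i ≫ p = 0 := by rw [← cancel_mono i, Category.assoc, hpi, hif, zero_comp]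
  have hker : (ShortComplex.mk i f hif).Exact := by
    refine ShortComplex.exact_of_iso ?_ (ShortComplex.exact_kernel f)
    exact ShortComplex.isoMk e.symm (Iso.refl _) (Iso.refl _) (by simp [i]) (by simp)
  refine ⟨P, i, p, w, hP, ⟨?_⟩, fun L hL' g ↦ ?_⟩
  · let φ : ShortComplex.mk i p w ⟶ ShortComplex.mk i f hif :=
      { τ₁ := 𝟙 _, τ₂ := 𝟙 _, τ₃ := i, comm₂₃ := by simp [hpi] }
    have : Epi φ.τ₁ := inferInstanceAs (Epi (𝟙 _))
    have : IsIso φ.τ₂ := inferInstanceAs (IsIso (𝟙 _))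
    have : Mono φ.τ₃ := ‹_›
    exact (ShortComplex.exact_iff_of_epi_of_isIso_of_mono φ).2 hker
  · have hfp : f ≫ p = 0 := by rw [← hpi, Category.assoc, w, comp_zero]
    obtain ⟨k, hk⟩ := (hL L hL' (p ≫ g)).1 (by simp [reassoc_of% hfp])
    refine ⟨k, ?_⟩
    rw [← cancel_epi p, ← hk, reassoc_of% hpi]

/-- Every module is a quotient of a projective module (a free one) lying in `ℒ`. -/
lemma IsPerfectDualityPair.exists_projective_presentation {𝒜 : ObjectProperty (ModuleCat.{u} Rᵐᵒᵖ)}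
    (h : IsPerfectDualityPair ℒ 𝒜) (X : ModuleCat.{u} R) :
    ∃ (Q : ModuleCat.{u} R) (q : Q ⟶ X), Projective Q ∧ Epi q ∧ ℒ Q := by
  have : Projective (ModuleCat.of R R) :=
    ModuleCat.projective_of_free (Module.Basis.singleton PUnit.{1} R)
  refine ⟨∐ fun _ : X ↦ ModuleCat.of R R,
    Sigma.desc fun x ↦ ModuleCat.ofHom (LinearMap.toSpanSingleton R X x), inferInstance, ?_,
    h.coproduct _ _ fun _ ↦ h.ring_mem⟩
  rw [ModuleCat.epi_iff_surjective]
  intro x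
  refine ⟨Sigma.ι (fun _ : X ↦ ModuleCat.of R R) x (1 : R), ?_⟩
  rw [← ModuleCat.comp_apply, Sigma.ι_desc]
  simp

variable {P : ModuleCat.{u} R} {i : G ⟶ P} {p : P ⟶ G} {w : i ≫ p = 0}

lemma mem_rightPerp_iff (hS : (ShortComplex.mk i p w).ShortExact) [Projective P]
    (Y : ModuleCat.{u} R) : rightPerp (fun X ↦ X = G) Y ↔ extendsAlong i Y := by
  rw [← subsingleton_ext_iff_extendsAlong hS]
  exact ⟨fun h ↦ h G rfl, by rintro h _ rfl; exact h⟩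

/-- The kernel `K` of an epimorphism `Q ⟶ X` with `Q` projective in `G^⊥` is again in `G^⊥`, so
`Ext¹(X, K)` vanishes and `X` is a retract of `Q`. -/
lemma projective_of_mem_core (hS : (ShortComplex.mk i p w).ShortExact) [Projective P]
    (hcov : ∀ X : ModuleCat.{u} R, ∃ (Q : ModuleCat.{u} R) (q : Q ⟶ X),
      Projective Q ∧ Epi q ∧ extendsAlong i Q)
    {X : ModuleCat.{u} R} (hX : leftPerp (extendsAlong i) X) (hX' : extendsAlong i X) :
    Projective X := by
  obtain ⟨Q, q, hQ, hq, hQ'⟩ := hcov X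
  have h : (ShortComplex.mk (kernel.ι q) q (by simp)).ShortExact :=
    { exact := ShortComplex.exact_kernel q, mono_f := inferInstanceAs (Mono (kernel.ι q)),
      epi_g := hq }
  obtain ⟨s, hs⟩ := exists_lift_of_subsingleton_ext h
    (hX _ (extendsAlong_left hS h hQ' hX')) (𝟙 X)
  exact (Retract.mk s q hs).projective

/-- For `Y` in `G^⊥` and an injective `E` containing `Y`, the quotient `E / Y` is again in `G^⊥`, so a
map `X₁ ⟶ E / Y` extends to `X₂`, and from the projective `X₂` it lifts to `E`. -/
lemma leftPerp_left (hS : (ShortComplex.mk i p w).ShortExact) [Projective P]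
    {S : ShortComplex (ModuleCat.{u} R)} (h : S.ShortExact) [Projective S.X₂]
    (h₃ : leftPerp (extendsAlong i) S.X₃) : leftPerp (extendsAlong i) S.X₁ := by
  intro Y hY
  let E : ShortComplex (ModuleCat.{u} R) :=
    .mk (Injective.ι Y) (cokernel.π (Injective.ι Y)) (by simp)
  have hE : E.ShortExact :=
    { exact := ShortComplex.exact_cokernel _
      mono_f := inferInstanceAs (Mono (Injective.ι Y))
      epi_g := inferInstanceAs (Epi (cokernel.π _)) }
  have := hE.epi_g
  have := hS.mono_f
  have : Subsingleton (Abelian.Ext S.X₁ E.X₂ 1) :=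
    Abelian.Ext.subsingleton_of_injective _ (Injective.under Y) 0
  refine subsingleton_ext_of_lift hE fun g ↦ ?_
  have hY' : extendsAlong i E.X₃ := extendsAlong_right hS hE hY fun g ↦
    ⟨Injective.factorThru (J := Injective.under Y) g i, Injective.comp_factorThru g i⟩
  obtain ⟨k, rfl⟩ := exists_extension_of_subsingleton_ext h (h₃ _ hY') g
  exact ⟨S.f ≫ Projective.factorThru k E.g, by simp⟩

theorem isGorensteinProjective_of_mem_leftPerp {𝒜 : ObjectProperty (ModuleCat.{u} Rᵐᵒᵖ)}
    (h : IsPerfectDualityPair ℒ 𝒜) (hG : IsStronglyGorensteinProjective ℒ G)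
    {M : ModuleCat.{u} R} (hM : leftPerp (rightPerp fun X ↦ X = G) M) :
    IsGorensteinProjective ℒ M := by
  obtain ⟨P, i, p, w, hP, hS, hL⟩ := hG.exists_shortExact
  have hcov (X : ModuleCat.{u} R) : ∃ (Q : ModuleCat.{u} R) (q : Q ⟶ X),
      Projective Q ∧ Epi q ∧ extendsAlong i Q := by
    obtain ⟨Q, q, hQ, hq, hQ'⟩ := h.exists_projective_presentation X
    exact ⟨Q, q, hQ, hq, hL Q hQ'⟩
  rw [show rightPerp (fun X ↦ X = G) = extendsAlong i from
    funext fun Y ↦ propext (mem_rightPerp_iff hS Y)] at hM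
  -- `r A B` when `B` is a syzygy of `A`: sequences ending in `A` come from projective presentations,
  -- those starting in `B` from special preenvelopes.
  let r (A B : {X // leftPerp (extendsAlong i) X}) : Prop :=
    ∃ (X : ModuleCat.{u} R) (f : B.1 ⟶ X) (g : X ⟶ A.1) (w : f ≫ g = 0),
      Projective X ∧ (ShortComplex.mk f g w).ShortExact
  have hr (A) : ∃ B, r A B := by
    obtain ⟨Q, q, hQ, hq, -⟩ := hcov A.1
    have hK : (ShortComplex.mk (kernel.ι q) q (by simp)).ShortExact :=
      { exact := ShortComplex.exact_kernel q, mono_f := inferInstanceAs (Mono (kernel.ι q)),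
        epi_g := hq }
    have : Projective (ShortComplex.mk (kernel.ι q) q (by simp)).X₂ := hQ
    exact ⟨⟨kernel q, leftPerp_left hS hK A.2⟩, Q, _, _, _, hQ, hK⟩
  have hl (B) : ∃ A, r A B := by
    have := hS.mono_f
    obtain ⟨W, j, hj, hW, hc⟩ := exists_special_preenvelope i B.1
    have hK : (ShortComplex.mk j (cokernel.π j) (by simp)).ShortExact :=
      { exact := ShortComplex.exact_cokernel j, mono_f := hj,
        epi_g := inferInstanceAs (Epi (cokernel.π j)) }
    refine ⟨⟨cokernel j, hc⟩, W, _, _, _,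
      projective_of_mem_core hS hcov (fun Y hY ↦ ?_) hW, hK⟩
    have := B.2 Y hY
    have := hc Y hY
    exact subsingleton_ext_middle hK
  obtain ⟨Z, hZ, hrZ⟩ := exists_int_sequence r hr hl ⟨M, hM⟩
  choose X ι π w' hX hι using hrZ
  refine ⟨splice (Z := fun n ↦ (Z n).1) ι π w', hX, splice_acyclic hι, fun L hL' n ↦
    splice_hom_exact (Z := fun n ↦ (Z n).1) hι
      (fun n ↦ exists_extension_of_subsingleton_ext (hι n) ((Z n).2 L (hL L hL')))
      rfl (by simp), ?_⟩
  have := nonempty_iso_kernel_splice_d (Z := fun n ↦ (Z n).1) hι (show (-2 : ℤ) + 1 = -1 by simp)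
  rwa [show (-1 : ℤ) + 1 = 0 by simp, hZ] at this

theorem mem_leftPerp_of_isDirectSummand {M : ModuleCat.{u} R} (h : IsDirectSummand M G) :
    leftPerp (rightPerp fun X ↦ X = G) M := by
  intro Y hY
  obtain ⟨r⟩ := IsDirectSummand.retract h
  have := hY G rfl
  exact subsingleton_ext_of_retract r

end Modules

/-! ### The direct sum of all shifts of a complex -/

section TotalSum

variable {R : Type u} [Ring R] (P : ChainComplex (ModuleCat.{u} R) ℤ)

/-- The differential of a complex `P`, as an endomorphism of the direct sum of all `P.X n`:
the component of degree `n` of `sumD P x` is `d (x (n + 1))`. -/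
noncomputable def sumD : (Π₀ n, P.X n) →ₗ[R] Π₀ n, P.X n where
  toFun x := (x.comapDomain (· + 1) (add_left_injective 1)).mapRange
    (fun n ↦ P.d (n + 1) n) fun n ↦ map_zero _
  map_add' x y := by ext n; simp
  map_smul' r x := by ext n; simp

@[simp]
lemma sumD_apply (x : Π₀ n, P.X n) (n : ℤ) : sumD P x n = P.d (n + 1) n (x (n + 1)) := by
  simp [sumD]

lemma sumD_single (n : ℤ) (a : P.X (n + 1)) :
    sumD P (DFinsupp.single (n + 1) a) = DFinsupp.single n (P.d (n + 1) n a) := by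
  ext m
  rw [sumD_apply]
  by_cases h : n = m
  · subst h; simp
  · rw [DFinsupp.single_eq_of_ne (by simpa using Ne.symm h),
      DFinsupp.single_eq_of_ne (Ne.symm h), map_zero]

variable {P}

lemma exact_d_of_acyclic (hP : P.Acyclic) {a b c : ℤ} (hab : b + 1 = a) (hbc : c + 1 = b) :
    Function.Exact (P.d a b) (P.d b c) := by
  have := (HomologicalComplex.exactAt_iff' P a b c (by simp [hab]) (by simp [← hbc])).1 (hP b)
  exact (ShortComplex.ShortExact.moduleCat_exact_iff_function_exact _).1 this

lemma exact_sumD (hP : P.Acyclic) : Function.Exact (sumD P) (sumD P) := by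
  classical
  intro x
  constructor
  · intro hx
    have h (n : ℤ) : ∃ a, P.d (n + 1) n a = x n := by
      obtain ⟨m, rfl⟩ : ∃ m, n = m + 1 := ⟨n - 1, by simp⟩
      refine (exact_d_of_acyclic hP rfl rfl _).1 ?_
      rw [← sumD_apply, hx, DFinsupp.zero_apply]
    choose a ha using h
    refine ⟨∑ n ∈ x.support, DFinsupp.single (n + 1) (a n), ?_⟩
    simp only [map_sum, sumD_single, ha]
    exact x.sum_single
  · rintro ⟨y, rfl⟩
    ext n
    simp only [sumD_apply, DFinsupp.zero_apply]
    exact (exact_d_of_acyclic hP rfl rfl).apply_apply_eq_zero _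

theorem exists_isDirectSummand_of_isGorensteinProjective
    {ℒ : ObjectProperty (ModuleCat.{u} R)} {M : ModuleCat.{u} R}
    (hM : IsGorensteinProjective ℒ M) :
    ∃ G, IsStronglyGorensteinProjective ℒ G ∧ IsDirectSummand M G := by
  classical
  obtain ⟨P, hproj, hP, hL, ⟨e⟩⟩ := hM
  let T : ModuleCat.{u} R := ModuleCat.of R (Π₀ n, P.X n)
  let f : T ⟶ T := ModuleCat.ofHom (sumD P)
  let s (n : ℤ) : P.X n ⟶ T := ModuleCat.ofHom (DFinsupp.lsingle (M := fun n ↦ P.X n) n)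
  let ev (n : ℤ) : T ⟶ P.X n := ModuleCat.ofHom (DFinsupp.lapply (M := fun n ↦ P.X n) n)
  have hsf (n : ℤ) : s (n + 1) ≫ f = P.d (n + 1) n ≫ s n := by
    ext a : 2
    exact sumD_single P n a
  have hfe (n : ℤ) : f ≫ ev n = ev (n + 1) ≫ P.d (n + 1) n :=
     ModuleCat.hom_ext (LinearMap.ext fun x ↦ sumD_apply P x n)
  have hse (n : ℤ) : s n ≫ ev n = 𝟙 _ := by
    ext a
    exact DFinsupp.single_eq_same
  have hom_ext {L : ModuleCat.{u} R} {g g' : T ⟶ L} (h : ∀ n, s n ≫ g = s n ≫ g') : g = g' := by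
    ext1
    exact DFinsupp.lhom_ext' fun n ↦ congrArg ModuleCat.Hom.hom (h n)
  have desc {L : ModuleCat.{u} R} (k : ∀ n, P.X n ⟶ L) : ∃ g : T ⟶ L, ∀ n, s n ≫ g = k n := by
    refine ⟨ModuleCat.ofHom (DFinsupp.lsum ℕ fun n ↦ (k n).hom), fun n ↦ ?_⟩
    ext a
    exact DFinsupp.lsum_single ℕ (fun n ↦ (k n).hom) n a
  have hT : Projective T := ⟨fun {E X} g q _ ↦ by
    obtain ⟨l, hl⟩ := desc fun n ↦ Projective.factorThru (s n ≫ g) q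
    exact ⟨l, hom_ext fun n ↦ by rw [reassoc_of% hl, Projective.factorThru_comp]⟩⟩
  have hff : f ≫ f = 0 := hom_ext fun n ↦ by
    obtain ⟨m, rfl⟩ : ∃ m, n = m + 1 + 1 := ⟨n - 1 - 1, by simp⟩
    rw [reassoc_of% hsf (m + 1), hsf]
    simp
  refine ⟨kernel f, ⟨T, f, hT, exact_sumD hP, fun L hL' g ↦ ⟨fun hg ↦ ?_, ?_⟩, ⟨Iso.refl _⟩⟩, ?_⟩
  · have hk (n : ℤ) : ∃ k : P.X n ⟶ L, P.d (n + 1) n ≫ k = s (n + 1) ≫ g := by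
      have h := hL L hL' (n + 1)
      rw [add_sub_cancel_right] at h
      refine (h _).1 ?_
      have : f ≫ g = 0 := hg
      simp only
      rw [← reassoc_of% hsf (n + 1), this, comp_zero]
    choose k hk using hk
    obtain ⟨l, hl⟩ := desc k
    refine ⟨l, hom_ext fun n ↦ ?_⟩
    obtain ⟨m, rfl⟩ : ∃ m, n = m + 1 := ⟨n - 1, by simp⟩
    simp only
    rw [reassoc_of% hsf, hl, hk]
  · rintro ⟨k, rfl⟩
    simp [reassoc_of% hff]
  · have h₁ := hsf (-2)
    have h₂ := hfe (-2)
    rw [show (-2 : ℤ) + 1 = -1 by simp] at h₁ h₂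
    refine isDirectSummand_of_retract
      { i := e.hom ≫ kernel.map _ _ (s (-1)) (s (-2)) h₁.symm
        r := kernel.map _ _ (ev (-1)) (ev (-2)) h₂ ≫ e.inv
        retract := ?_ }
    rw [← cancel_mono e.hom, ← cancel_mono (kernel.ι _)]
    simp [hse]

end TotalSum

end GorensteinLA

theorem proposition4p7 {R : Type u} [Ring R]
    (ℒ : CategoryTheory.ObjectProperty (ModuleCat.{u} R))
    (𝒜 : CategoryTheory.ObjectProperty (ModuleCat.{u} Rᵐᵒᵖ))
    (h : GorensteinLA.IsCompleteDualityPair ℒ 𝒜) (M : ModuleCat.{u} R) :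
    List.TFAE [
      GorensteinLA.IsGorensteinProjective ℒ M,
      ∃ G : ModuleCat.{u} R, GorensteinLA.IsStronglyGorensteinProjective ℒ G ∧
        GorensteinLA.IsDirectSummand M G,
      ∃ G : ModuleCat.{u} R, GorensteinLA.IsStronglyGorensteinProjective ℒ G ∧
        GorensteinLA.leftPerp (GorensteinLA.rightPerp (fun X => X = G)) M] := by
  tfae_have 1 → 2 := GorensteinLA.exists_isDirectSummand_of_isGorensteinProjective
  tfae_have 2 → 3 := fun ⟨G, hG, hM⟩ ↦
    ⟨G, hG, GorensteinLA.mem_leftPerp_of_isDirectSummand hM⟩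
  tfae_have 3 → 1 := fun ⟨_, hG, hM⟩ ↦
    GorensteinLA.isGorensteinProjective_of_mem_leftPerp h.toIsPerfectDualityPair hG hM
  tfae_finish
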